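/- Let $\tau$ be a finite set of proposition symbols and $t=2^{|\tau|}$. Formulas of $\mathrm{GMLU}[\tau]$ are generated by $$\varphi ::= Q\psi \mid Q\varphi \mid \varphi\land\varphi \mid \varphi\lor\varphi,\qquad \psi ::= p \mid \neg p \mid \psi\land\psi \mid \psi\lor\psi \quad (p\in\tau),$$ where $Q$ is one of the modalities $\Diamond^{\ge k},\Box^{<k},\Diamond^{=k},\Box^{\neq k}$ with $k\in\mathbb N=\{0,1,2,\dots\}$. In a model, $\Diamond^{\ge k}\chi$ (resp. $\Diamond^{=k}\chi$) says that at least (resp. exactly) $k$ points satisfy $\chi$, while $\Box^{<k}$ and $\Box^{\neq k}$ are the duals, saying that the number of points not satisfying $\chi$ is $<k$ (resp. $\neq k$). A formula is true in a model if it is true at all its points. The size of a formula counts $1$ for each literal and each $\land,\lor$, counts $k$ for each $\Diamond^{\ge k},\Box^{<k}$, and counts $k+1$ for each $\Diamond^{=k},\Box^{\neq k}$. The counting depth is the maximum, over the modalities occurring in the formula, of $k$ for $\Diamond^{\ge k},\Box^{<k}$ and of $k+1$ for $\Diamond^{=k},\Box^{\neq k}$. $\mathrm{GMLU}_d$ consists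 of the formulas of counting depth at most $d$. Let $\mathcal M$ be the set of all $\tau$-models with domain $\{1,\dots,n\}$, and let $\equiv_d$ be the relation on $\mathcal M$ of satisfying the same $\mathrm{GMLU}_d$-formulas. A formula $\varphi$ defines $M\subseteq\mathcal M$ if $M$ is the set of models in $\mathcal M$ where $\varphi$ is true; $C(M)$ is the minimum size of a $\mathrm{GMLU}_d$-formula defining $M$ (for $M$ definable in $\mathrm{GMLU}_d$), and $H_B(M)=\log_2|M|$. Let $(\pi_i)_{i\in I}$ enumerate the $t$ propositional types over $\tau$ (choices of exactly one of $p,\neg p$ for each $p\in\tau$). A tuple $\overline n=(n_i)_{i\in I}$ of natural numbers is $(n,d)$-admissible if $n_i\le d$ for all $i$, $\sum_i n_i\le n$, and either $n_i=d$ for some $i$ or $\sum_i n_i=n$. Let $M_{\overline n}\subseteq\mathcal M$ be the set of models in which, for every $i$, the type $\pi_i$ is realized by exactly $n_i$ points if $n_i<d$ and by at least $d$ points if $n_i=d$. Let $c_\tau=2^{|\tau|}(2|\tau|+1)-1$, and write $\overline n\preceq_\tau\overline n'$ if $n_i\le n_i'$ for all $i$ and either $\overline n=\overline n'$ or $\sum_i(n_i'-n_i)>c_\tau$.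 **Corollary.** For every finite $\tau$ and every integer $d\ge 1$ there is $N$ such that for all $n\ge N$ the following holds. If $\overline n$ and $\overline n'$ are distinct $(n,d)$-admissible tuples with $\overline n\preceq_\tau\overline n'$ or $\overline n'\preceq_\tau\overline n$, then $M_{\overline n}$ and $M_{\overline n'}$ are $\mathrm{GMLU}_d$-definable equivalence classes of $\equiv_d$, and $$H_B(M_{\overline n})<H_B(M_{\overline n'})\iff C(M_{\overline n})<C(M_{\overline n'}).$$ -/

import Mathlib

open scoped BigOperators

namespace GMLU

universe u

/-! Throughout, `τ` is a finite set of proposition symbols and the domain of the models is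
`Fin n`. -/

/-- Propositional formulas in negation normal form. -/
inductive PropForm (τ : Type u) : Type u
  | pos (p : τ) : PropForm τ
  | neg (p : τ) : PropForm τ
  | and (ψ χ : PropForm τ) : PropForm τ
  | or (ψ χ : PropForm τ) : PropForm τ

/-- The four global graded modalities. -/
inductive Modality : Type
  | diaGe (k : ℕ) : Modality
  | boxLt (k : ℕ) : Modality
  | diaEq (k : ℕ) : Modality
  | boxNe (k : ℕ) : Modality

/-- Formulas of graded universal modal logic: proposition symbols occur only in the scope of a
modality, a modality is applied either to a propositional formula or to a formula of the logic. -/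
inductive Form (τ : Type u) : Type u
  | modProp (Q : Modality) (ψ : PropForm τ) : Form τ
  | mod (Q : Modality) (φ : Form τ) : Form τ
  | and (φ χ : Form τ) : Form τ
  | or (φ χ : Form τ) : Form τ

/-- A `τ`-model with domain `Fin n`: the truth value of each symbol at each point. -/
abbrev Model (τ : Type u) (n : ℕ) : Type u := τ → Fin n → Bool

/-- A propositional type chooses, for each symbol `p`, exactly one of `p` (`true`) and
`¬p` (`false`). -/
abbrev PType (τ : Type u) : Type u := τ → Bool

/-- Truth of a propositional formula at a point. -/
def PropForm.Sat {τ : Type u} {n : ℕ} (𝔐 : Model τ n) (w : Fin n) : PropForm τ → Prop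
  | .pos p => 𝔐 p w = true
  | .neg p => 𝔐 p w = false
  | .and ψ χ => ψ.Sat 𝔐 w ∧ χ.Sat 𝔐 w
  | .or ψ χ => ψ.Sat 𝔐 w ∨ χ.Sat 𝔐 w

/-- Truth of a modality applied to a formula which is true exactly at the points of `S`.
The boxes are the duals of the diamonds. -/
def Modality.Holds {n : ℕ} (S : Set (Fin n)) : Modality → Prop
  | .diaGe k => k ≤ S.ncard
  | .boxLt k => ¬ k ≤ Sᶜ.ncard
  | .diaEq k => S.ncard = k
  | .boxNe k => ¬ Sᶜ.ncard = k

/-- Truth of a formula at a point. -/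
def Form.Sat {τ : Type u} {n : ℕ} (𝔐 : Model τ n) : Fin n → Form τ → Prop
  | _, .modProp Q ψ => Q.Holds {v | ψ.Sat 𝔐 v}
  | _, .mod Q φ => Q.Holds {v | Form.Sat 𝔐 v φ}
  | w, .and φ χ => Form.Sat 𝔐 w φ ∧ Form.Sat 𝔐 w χ
  | w, .or φ χ => Form.Sat 𝔐 w φ ∨ Form.Sat 𝔐 w χ

/-- Point-free truth in a model. -/
def Models {τ : Type u} {n : ℕ} (𝔐 : Model τ n) (φ : Form τ) : Prop :=
  ∀ w, φ.Sat 𝔐 w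

/-- The number up to which a modality counts. -/
def Modality.depth : Modality → ℕ
  | .diaGe k => k
  | .boxLt k => k
  | .diaEq k => k + 1
  | .boxNe k => k + 1

/-- Counting depth (propositional formulas have counting depth `0`). -/
def Form.depth {τ : Type u} : Form τ → ℕ
  | .modProp Q _ => Q.depth
  | .mod Q φ => max Q.depth φ.depth
  | .and φ χ => max φ.depth χ.depth
  | .or φ χ => max φ.depth χ.depth

/-- The contribution of a modality to the size of a formula. -/
def Modality.size : Modality → ℕ
  | .diaGe k => k
  | .boxLt k => k
  | .diaEq k => k + 1
  | .boxNe k => k + 1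

/-- Size of a propositional formula; all literals have size `1`. -/
def PropForm.size {τ : Type u} : PropForm τ → ℕ
  | .pos _ => 1
  | .neg _ => 1
  | .and ψ χ => ψ.size + χ.size + 1
  | .or ψ χ => ψ.size + χ.size + 1

/-- Size of a formula. -/
def Form.size {τ : Type u} : Form τ → ℕ
  | .modProp Q ψ => ψ.size + Q.size
  | .mod Q φ => φ.size + Q.size
  | .and φ χ => φ.size + χ.size + 1
  | .or φ χ => φ.size + χ.size + 1

/-- `φ` defines the set `S` among the models with domain `Fin n`. -/
def Defines {τ : Type u} {n : ℕ} (φ : Form τ) (S : Set (Model τ n)) : Prop :=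
  ∀ 𝔐 : Model τ n, Models 𝔐 φ ↔ 𝔐 ∈ S

/-- `S` is definable by a formula of counting depth at most `d`. -/
def Definable {τ : Type u} {n : ℕ} (d : ℕ) (S : Set (Model τ n)) : Prop :=
  ∃ φ : Form τ, φ.depth ≤ d ∧ Defines φ S

/-- Description complexity: the minimum size of a formula of counting depth at most `d` that
defines `S` (meaningful for definable `S`). -/
noncomputable def descComplexity {τ : Type u} {n : ℕ} (d : ℕ) (S : Set (Model τ n)) : ℕ :=
  sInf {s | ∃ φ : Form τ, φ.depth ≤ d ∧ Defines φ S ∧ φ.size = s}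

/-- The relation `≡_d`: satisfying the same formulas of counting depth at most `d`. -/
def equivSetoid (τ : Type u) (n d : ℕ) : Setoid (Model τ n) where
  r 𝔐 𝔑 := ∀ φ : Form τ, φ.depth ≤ d → (Models 𝔐 φ ↔ Models 𝔑 φ)
  iseqv :=
    ⟨fun _ _ _ => Iff.rfl, fun h φ hφ => (h φ hφ).symm,
      fun h₁ h₂ φ hφ => (h₁ φ hφ).trans (h₂ φ hφ)⟩

/-- The number of points of the model `𝔐` that realize the type `π`. -/
noncomputable def typeCount {τ : Type u} {n : ℕ} (𝔐 : Model τ n) (π : PType τ) : ℕ :=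
  Set.ncard {w : Fin n | ∀ p, 𝔐 p w = π p}

/-- The tuple of a model: the numbers of points realizing the types, cut off at `d`. Tuples are
indexed by the types themselves. -/
noncomputable def typeTuple {τ : Type u} {n : ℕ} (d : ℕ) (𝔐 : Model τ n) : PType τ → ℕ :=
  fun π => min (typeCount 𝔐 π) d

/-- The class `M_ν` of the models of size `n` that corresponds to the tuple `ν`: type `π` is
realized exactly `ν π` times if `ν π < d` and at least `d` times if `ν π = d`. -/
def modelClass {τ : Type u} (n d : ℕ) (ν : PType τ → ℕ) : Set (Model τ n) :=
  {𝔐 | typeTuple d 𝔐 = ν}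

/-- `(n, d)`-admissible tuples. -/
def Admissible {τ : Type u} [Fintype τ] [DecidableEq τ] (n d : ℕ) (ν : PType τ → ℕ) : Prop :=
  (∀ π, ν π ≤ d) ∧ (∑ π, ν π) ≤ n ∧ ((∃ π, ν π = d) ∨ (∑ π, ν π) = n)

/-- The constant `c_τ = 2 ^ |τ| * (2 * |τ| + 1) - 1`. -/
def cTau (τ : Type u) [Fintype τ] : ℤ :=
  2 ^ Fintype.card τ * (2 * (Fintype.card τ : ℤ) + 1) - 1

/-- The order `⪯_τ` on tuples. -/
def LeTau {τ : Type u} [Fintype τ] [DecidableEq τ] (ν ν' : PType τ → ℕ) : Prop :=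
  (∀ π, ν π ≤ ν' π) ∧ (ν = ν' ∨ cTau τ < ∑ π, ((ν' π : ℤ) - (ν π : ℤ)))

/-- Boltzmann entropy of a class, with the binary logarithm. -/
noncomputable def boltzmann {τ : Type u} {n : ℕ} (S : Set (Model τ n)) : ℝ :=
  Real.logb 2 (S.ncard : ℝ)

end GMLU

/-! Both sides of the equivalence are strictly monotone along `LeTau`, so they are true together or
false together. Let t be the number of types and n > 2dt; then every admissible tuple has a
coordinate equal to d.

Entropy: raising one coordinate below d by one enlarges the class, by double counting the moves of a
point out of a type realized more than d times (`ncard_modelClass_lt_update`).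

Complexity: conjoining one counting formula per type bounds it above by the sum of the tuple plus
`cTau`. Conversely, if j has coordinate d, a defining formula must detect the move of one point from
a type i ≠ j to j. This forces a modality that counts as far as the tuple's total over a set of
types containing i, so the size is at least the sum over such i (`sum_le_descComplexity`). A gap
above `cTau` separates the bounds; a unique coordinate d of the larger tuple is dropped from both
(`descComplexity_lt`). -/

namespace GMLU

set_option linter.unusedSectionVars false

/-! ### Propositional types and type counts -/

section

variable {τ : Type*} {n : ℕ}

/-- The propositional type realized by a point. -/
def pointType (𝔐 : Model τ n) (w : Fin n) : PType τ := fun p => 𝔐 p w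

/-- The model obtained by changing the propositional type of one point. -/
def setType (𝔐 : Model τ n) (w : Fin n) (π : PType τ) : Model τ n :=
  fun p v => if v = w then π p else 𝔐 p v

/-- Truth of a propositional formula under a propositional type. -/
def PropForm.TypeSat (π : PType τ) : PropForm τ → Prop
  | .pos p => π p = true
  | .neg p => π p = false
  | .and ψ χ => ψ.TypeSat π ∧ χ.TypeSat π
  | .or ψ χ => ψ.TypeSat π ∨ χ.TypeSat π

theorem PropForm.sat_iff_typeSat (𝔐 : Model τ n) (w : Fin n) (ψ : PropForm τ) :
    ψ.Sat 𝔐 w ↔ ψ.TypeSat (pointType 𝔐 w) := by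
  induction ψ with
  | pos p => rfl
  | neg p => rfl
  | and ψ χ h₁ h₂ => simp only [PropForm.Sat, PropForm.TypeSat, h₁, h₂]
  | or ψ χ h₁ h₂ => simp only [PropForm.Sat, PropForm.TypeSat, h₁, h₂]

/-- The points that a modality counts. -/
def Modality.counted {α : Type*} (S : Set α) : Modality → Set α
  | .diaGe _ => S
  | .boxLt _ => Sᶜ
  | .diaEq _ => S
  | .boxNe _ => Sᶜ

theorem Modality.size_eq_depth (Q : Modality) : Q.size = Q.depth := by
  cases Q <;> rfl

theorem Modality.holds_congr (Q : Modality) {S T : Set (Fin n)}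
    (h : min (Q.counted S).ncard Q.depth = min (Q.counted T).ncard Q.depth) :
    Q.Holds S ↔ Q.Holds T := by
  cases Q <;> simp only [Modality.counted, Modality.depth, Modality.Holds] at * <;> omega

theorem Modality.counted_preimage {α β : Type*} (Q : Modality) (f : α → β) (S : Set β) :
    Q.counted (f ⁻¹' S) = f ⁻¹' Q.counted S := by
  cases Q <;> rfl

theorem setType_pointType (𝔐 : Model τ n) (w : Fin n) (π : PType τ) :
    setType (setType 𝔐 w π) w (pointType 𝔐 w) = 𝔐 := by
  funext p v
  by_cases h : v = w
  · subst h; simp [setType, pointType]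
  · simp [setType, h]

theorem pointType_setType (𝔐 : Model τ n) (w : Fin n) (π : PType τ) :
    pointType (setType 𝔐 w π) w = π := by
  funext p; simp [setType, pointType]

theorem exists_propForm_agree (n : ℕ) (π : PType τ) {S : Finset τ} (hS : S.Nonempty) :
    ∃ ψ : PropForm τ, ψ.size + 1 = 2 * S.card ∧
      ∀ (𝔐 : Model τ n) (w : Fin n), ψ.Sat 𝔐 w ↔ ∀ p ∈ S, 𝔐 p w = π p := by
  have lit : ∀ p, ∃ ψ : PropForm τ, ψ.size = 1 ∧
      ∀ (𝔐 : Model τ n) (w : Fin n), ψ.Sat 𝔐 w ↔ 𝔐 p w = π p := by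
    intro p
    cases h : π p
    · exact ⟨.neg p, rfl, fun 𝔐 w => by simp [PropForm.Sat]⟩
    · exact ⟨.pos p, rfl, fun 𝔐 w => by simp [PropForm.Sat]⟩
  induction hS using Finset.Nonempty.cons_induction with
  | singleton p =>
    obtain ⟨ψ, h₁, h₂⟩ := lit p
    exact ⟨ψ, by simp [h₁], by simpa using h₂⟩
  | cons p S hp hS ih =>
    obtain ⟨ψ, h₁, h₂⟩ := lit p
    obtain ⟨χ, h₃, h₄⟩ := ih
    refine ⟨.and ψ χ, ?_, fun 𝔐 w => ?_⟩
    · simp only [PropForm.size, Finset.card_cons]; omega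
    · simp [PropForm.Sat, h₂, h₄]

theorem exists_size_eq_descComplexity {d : ℕ} {S : Set (Model τ n)} (h : Definable d S) :
    ∃ φ : Form τ, φ.depth ≤ d ∧ Defines φ S ∧ φ.size = descComplexity d S := by
  obtain ⟨φ, h₁, h₂⟩ := h
  exact Nat.sInf_mem (s := {s | ∃ φ : Form τ, φ.depth ≤ d ∧ Defines φ S ∧ φ.size = s})
    ⟨φ.size, φ, h₁, h₂, rfl⟩

variable [Fintype τ] [DecidableEq τ]

theorem typeCount_eq_card (𝔐 : Model τ n) (π : PType τ) :
    typeCount 𝔐 π = (Finset.univ.filter fun w => pointType 𝔐 w = π).card := by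
  rw [typeCount, ← Set.ncard_coe_finset]
  congr 1
  ext w
  simp [pointType, funext_iff]

theorem sum_typeCount (𝔐 : Model τ n) (A : Finset (PType τ)) :
    ∑ π ∈ A, typeCount 𝔐 π = (pointType 𝔐 ⁻¹' (A : Set (PType τ))).ncard := by
  have h := Finset.card_eq_sum_card_fiberwise (f := pointType 𝔐)
    (s := Finset.univ.filter fun w => pointType 𝔐 w ∈ A) (t := A)
    (fun w hw => by simpa using hw)
  have h' : (pointType 𝔐 ⁻¹' (A : Set (PType τ))) =
      ((Finset.univ.filter fun w => pointType 𝔐 w ∈ A : Finset (Fin n)) : Set (Fin n)) := by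
    ext w; simp
  rw [h', Set.ncard_coe_finset, h]
  refine Finset.sum_congr rfl fun π hπ => ?_
  rw [typeCount_eq_card, Finset.filter_filter]
  congr 1
  ext w
  simp only [Finset.mem_filter, Finset.mem_univ, true_and]
  constructor
  · rintro rfl; exact ⟨hπ, rfl⟩
  · exact fun h => h.2

theorem sum_typeCount_univ (𝔐 : Model τ n) : ∑ π, typeCount 𝔐 π = n := by
  simp [sum_typeCount, Set.ncard_univ]

/-- The additive form avoids truncated subtraction and covers the case where the point already has
type `π`. -/
theorem typeCount_setType (𝔐 : Model τ n) (w : Fin n) (π ρ : PType τ) :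
    typeCount (setType 𝔐 w π) ρ + (if pointType 𝔐 w = ρ then 1 else 0) =
      typeCount 𝔐 ρ + (if π = ρ then 1 else 0) := by
  have key : ∀ 𝔑 : Model τ n, typeCount 𝔑 ρ =
      ((Finset.univ.erase w).filter fun v => pointType 𝔑 v = ρ).card +
        (if pointType 𝔑 w = ρ then 1 else 0) := by
    intro 𝔑
    rw [typeCount_eq_card, Finset.filter_erase]
    split_ifs with h
    · rw [Finset.card_erase_add_one]; simpa using h
    · rw [Finset.erase_eq_of_notMem (by simpa using h), add_zero]
  have hw : pointType (setType 𝔐 w π) w = π := by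
    funext p; simp [pointType, setType]
  have hv : ((Finset.univ.erase w).filter fun v => pointType (setType 𝔐 w π) v = ρ) =
      (Finset.univ.erase w).filter fun v => pointType 𝔐 v = ρ := by
    refine Finset.filter_congr fun v hv => ?_
    have : pointType (setType 𝔐 w π) v = pointType 𝔐 v := by
      funext p; simp [pointType, setType, Finset.ne_of_mem_erase hv]
    rw [this]
  rw [key 𝔐, key (setType 𝔐 w π), hw, hv]
  omega

theorem exists_model_of_sum_eq (c : PType τ → ℕ) (hc : ∑ π, c π = n) :
    ∃ 𝔐 : Model τ n, ∀ π, typeCount 𝔐 π = c π := by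
  have e : Fin n ≃ (Σ π : PType τ, Fin (c π)) := Fintype.equivOfCardEq (by simp [hc])
  refine ⟨fun p w => (e w).1 p, fun π => ?_⟩
  have : {w : Fin n | ∀ p, (e w).1 p = π p} = e ⁻¹' (Set.range (Sigma.mk π)) := by
    ext w
    simp only [Set.mem_ofPred_eq, Set.mem_preimage, Set.mem_range]
    constructor
    · intro h
      have h' : ∀ y : Σ π : PType τ, Fin (c π), y.1 = π → ∃ x, Sigma.mk π x = y := by
        rintro ⟨ρ, x⟩ rfl
        exact ⟨x, rfl⟩
      exact h' _ (funext h)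
    · rintro ⟨x, hx⟩ p
      rw [← hx]
  rw [typeCount, this, Set.ncard_preimage_of_injective_subset_range e.injective
    (by simp [e.surjective.range_eq]), ← Set.image_univ,
    Set.ncard_image_of_injective _ sigma_mk_injective]
  simp [Set.ncard_univ]

/-! ### Invariance: formulas see only the cut-off type counts -/

open scoped Classical in
/-- The types whose points are counted by `Q` applied to `ψ`. -/
noncomputable def countedTypes (Q : Modality) (ψ : PropForm τ) : Finset (PType τ) :=
  Finset.univ.filter fun π => π ∈ Q.counted {ρ | ψ.TypeSat ρ}

theorem ncard_counted (𝔐 : Model τ n) (Q : Modality) (ψ : PropForm τ) :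
    (Q.counted {v | ψ.Sat 𝔐 v}).ncard = ∑ π ∈ countedTypes Q ψ, typeCount 𝔐 π := by
  have : {v | ψ.Sat 𝔐 v} = pointType 𝔐 ⁻¹' {ρ | ψ.TypeSat ρ} := by
    ext v; exact ψ.sat_iff_typeSat 𝔐 v
  rw [sum_typeCount, this, Q.counted_preimage]
  congr 1
  ext v
  simp [countedTypes]

/-- A summand hidden by the cut-off at `d` already brings the sum up to `k`. -/
theorem min_sum_congr {ι : Type*} (A : Finset ι) {c c' : ι → ℕ} {d k : ℕ} (hk : k ≤ d)
    (h : ∀ i, min (c i) d = min (c' i) d) :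
    min (∑ i ∈ A, c i) k = min (∑ i ∈ A, c' i) k := by
  classical
  induction A using Finset.induction_on with
  | empty => rfl
  | insert i A hi ih =>
    rw [Finset.sum_insert hi, Finset.sum_insert hi]
    have := h i
    omega

theorem sat_congr_of_typeTuple_eq {d : ℕ} {𝔐 𝔑 : Model τ n}
    (h : typeTuple d 𝔐 = typeTuple d 𝔑) (φ : Form τ) (hφ : φ.depth ≤ d) (w : Fin n) :
    φ.Sat 𝔐 w ↔ φ.Sat 𝔑 w := by
  induction φ generalizing w with
  | modProp Q ψ =>
    refine Q.holds_congr ?_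
    rw [ncard_counted, ncard_counted]
    exact min_sum_congr _ hφ fun π => congrFun h π
  | mod Q φ ih =>
    have : {v | φ.Sat 𝔐 v} = {v | φ.Sat 𝔑 v} :=
      Set.ext fun v => ih (le_trans (le_max_right _ _) hφ) v
    simp only [Form.Sat, this]
  | and φ χ h₁ h₂ =>
    exact and_congr (h₁ (le_trans (le_max_left _ _) hφ) w) (h₂ (le_trans (le_max_right _ _) hφ) w)
  | or φ χ h₁ h₂ =>
    exact or_congr (h₁ (le_trans (le_max_left _ _) hφ) w) (h₂ (le_trans (le_max_right _ _) hφ) w)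

/-! ### Defining formulas -/

theorem exists_propForm_type [Nonempty τ] (n : ℕ) (π : PType τ) :
    ∃ ψ : PropForm τ, ψ.size + 1 = 2 * Fintype.card τ ∧
      ∀ 𝔐 : Model τ n, {w | ψ.Sat 𝔐 w}.ncard = typeCount 𝔐 π := by
  obtain ⟨ψ, h₁, h₂⟩ := exists_propForm_agree n π (Finset.univ_nonempty (α := τ))
  refine ⟨ψ, h₁, fun 𝔐 => ?_⟩
  simp [h₂, typeCount]

/-- Below `d` an exact count is affordable, as its depth is `k + 1`. At `k = d` it is not, but the
cut-off turns equality into "at least `d`". -/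
theorem exists_form_count [Nonempty τ] (n d k : ℕ) (hk : k ≤ d) (π : PType τ) :
    ∃ φ : Form τ, φ.depth ≤ d ∧ φ.size ≤ k + 2 * Fintype.card τ ∧
      ∀ (𝔐 : Model τ n) (w : Fin n), φ.Sat 𝔐 w ↔ typeTuple d 𝔐 π = k := by
  obtain ⟨ψ, h₁, h₂⟩ := exists_propForm_type n π
  rcases hk.lt_or_eq with hk | rfl
  · refine ⟨.modProp (.diaEq k) ψ, hk, ?_, fun 𝔐 w => ?_⟩
    · simp only [Form.size, Modality.size]; omega
    · simp only [Form.Sat, Modality.Holds, h₂, typeTuple]; omega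
  · refine ⟨.modProp (.diaGe k) ψ, le_rfl, ?_, fun 𝔐 w => ?_⟩
    · simp only [Form.size, Modality.size]; omega
    · simp only [Form.Sat, Modality.Holds, h₂, typeTuple]; omega

theorem exists_form_typeTuple_on [Nonempty τ] (n d : ℕ) {ν : PType τ → ℕ} (hν : ∀ π, ν π ≤ d)
    {S : Finset (PType τ)} (hS : S.Nonempty) :
    ∃ φ : Form τ, φ.depth ≤ d ∧ φ.size + 1 ≤ ∑ π ∈ S, (ν π + 2 * Fintype.card τ + 1) ∧
      ∀ (𝔐 : Model τ n) (w : Fin n), φ.Sat 𝔐 w ↔ ∀ π ∈ S, typeTuple d 𝔐 π = ν π := by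
  induction hS using Finset.Nonempty.cons_induction with
  | singleton π =>
    obtain ⟨φ, h₁, h₂, h₃⟩ := exists_form_count n d (ν π) (hν π) π
    exact ⟨φ, h₁, by simpa using h₂, by simpa using h₃⟩
  | cons π S hπ hS ih =>
    obtain ⟨φ, h₁, h₂, h₃⟩ := exists_form_count n d (ν π) (hν π) π
    obtain ⟨χ, h₄, h₅, h₆⟩ := ih
    refine ⟨.and φ χ, max_le h₁ h₄, ?_, fun 𝔐 w => ?_⟩
    · simp only [Form.size, Finset.sum_cons]; omega
    · simp [Form.Sat, h₃, h₆]

/-- Allowing a proper subset `S` saves the conjunct of a type whose count is forced by the others.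
-/
theorem exists_defines_modelClass [Nonempty τ] {d : ℕ} (hn : 0 < n) {ν : PType τ → ℕ}
    (hν : ∀ π, ν π ≤ d) {S : Finset (PType τ)} (hS : S.Nonempty)
    (hSν : ∀ 𝔐 : Model τ n, (∀ π ∈ S, typeTuple d 𝔐 π = ν π) → typeTuple d 𝔐 = ν) :
    ∃ φ : Form τ, φ.depth ≤ d ∧ Defines φ (modelClass n d ν) ∧
      φ.size + 1 ≤ ∑ π ∈ S, (ν π + 2 * Fintype.card τ + 1) := by
  obtain ⟨φ, h₁, h₂, h₃⟩ := exists_form_typeTuple_on n d hν hS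
  refine ⟨φ, h₁, fun 𝔐 => ?_, h₂⟩
  constructor
  -- A point is needed: in an empty domain every formula is vacuously true.
  · exact fun h => hSν 𝔐 ((h₃ 𝔐 ⟨0, hn⟩).1 (h _))
  · exact fun h w => (h₃ 𝔐 w).2 fun π _ => congrFun h π

theorem definable_modelClass [Nonempty τ] {d : ℕ} (hn : 0 < n) {ν : PType τ → ℕ}
    (hν : ∀ π, ν π ≤ d) : Definable d (modelClass n d ν) := by
  obtain ⟨φ, h₁, h₂, -⟩ := exists_defines_modelClass hn hν Finset.univ_nonempty
    fun 𝔐 h => funext fun π => h π (Finset.mem_univ π)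
  exact ⟨φ, h₁, h₂⟩

theorem descComplexity_add_one_le [Nonempty τ] {d : ℕ} (hn : 0 < n) {ν : PType τ → ℕ}
    (hν : ∀ π, ν π ≤ d) {S : Finset (PType τ)} (hS : S.Nonempty)
    (hSν : ∀ 𝔐 : Model τ n, (∀ π ∈ S, typeTuple d 𝔐 π = ν π) → typeTuple d 𝔐 = ν) :
    descComplexity d (modelClass n d ν) + 1 ≤ ∑ π ∈ S, (ν π + 2 * Fintype.card τ + 1) := by
  obtain ⟨φ, h₁, h₂, h₃⟩ := exists_defines_modelClass hn hν hS hSν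
  exact le_trans (Nat.succ_le_succ (Nat.sInf_le ⟨φ, h₁, h₂, rfl⟩)) h₃

/-! ### Models with all excess points in one type -/

theorem exists_model_excess {ν : PType τ → ℕ} (hsum : ∑ π, ν π ≤ n) (j : PType τ) :
    ∃ 𝔐 : Model τ n, (∀ π, π ≠ j → typeCount 𝔐 π = ν π) ∧
      typeCount 𝔐 j = ν j + (n - ∑ π, ν π) := by
  obtain ⟨𝔐, h⟩ := exists_model_of_sum_eq
    (fun π => ν π + if π = j then n - ∑ π, ν π else 0) (n := n) (by
      rw [Finset.sum_add_distrib, Finset.sum_ite_eq' Finset.univ j]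
      simp; omega)
  exact ⟨𝔐, fun π hπ => by simp [h, hπ], by simp [h]⟩

theorem mem_modelClass_of_excess {d : ℕ} {ν : PType τ → ℕ} (hν : ∀ π, ν π ≤ d) {j : PType τ}
    (hj : ν j = d) {𝔐 : Model τ n} (h : ∀ π, π ≠ j → typeCount 𝔐 π = ν π)
    (hj' : d ≤ typeCount 𝔐 j) : 𝔐 ∈ modelClass n d ν := by
  funext π
  simp only [typeTuple]
  by_cases hπ : π = j
  · subst hπ; omega
  · rw [h π hπ]; exact min_eq_left (hν π)

theorem modelClass_nonempty {d : ℕ} {ν : PType τ → ℕ} (hν : ∀ π, ν π ≤ d) {j : PType τ}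
    (hj : ν j = d) (hsum : ∑ π, ν π ≤ n) : (modelClass n d ν).Nonempty := by
  obtain ⟨𝔐, h, h'⟩ := exists_model_excess hsum j
  exact ⟨𝔐, mem_modelClass_of_excess hν hj h (by omega)⟩

theorem modelClass_mem_classes {d : ℕ} {ν : PType τ → ℕ} (hne : (modelClass n d ν).Nonempty)
    (hdef : Definable d (modelClass n d ν)) : modelClass n d ν ∈ (equivSetoid τ n d).classes := by
  obtain ⟨𝔐, h𝔐⟩ := hne
  obtain ⟨φ, h₁, h₂⟩ := hdef
  refine ⟨𝔐, Set.ext fun 𝔑 => ⟨fun h𝔑 χ hχ => ?_, fun h => ?_⟩⟩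
  · exact forall_congr' fun w => sat_congr_of_typeTuple_eq (h𝔑.trans h𝔐.symm) χ hχ w
  · exact (h₂ 𝔑).1 ((h φ h₁).2 ((h₂ 𝔐).2 h𝔐))

/-! ### Lower bound on description complexity -/

/-- The types counted by a modality of the formula that counts at least as far as the number of
points which the tuple prescribes for all types counted by that modality. -/
noncomputable def Form.covered (ν : PType τ → ℕ) : Form τ → Finset (PType τ)
  | .modProp Q ψ => if ∑ π ∈ countedTypes Q ψ, ν π ≤ Q.size then countedTypes Q ψ else ∅
  | .mod _ φ => φ.covered ν
  | .and φ χ => φ.covered ν ∪ χ.covered ν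
  | .or φ χ => φ.covered ν ∪ χ.covered ν

/-- A modality enters its types only if its own size pays for their total, and sums over unions are
subadditive. -/
theorem Form.sum_covered_le_size (ν : PType τ → ℕ) (φ : Form τ) :
    ∑ π ∈ φ.covered ν, ν π ≤ φ.size := by
  have union : ∀ A B : Finset (PType τ), ∑ π ∈ A ∪ B, ν π ≤ ∑ π ∈ A, ν π + ∑ π ∈ B, ν π := by
    intro A B
    rw [← Finset.sum_union_inter]
    exact Nat.le_add_right _ _
  induction φ with
  | modProp Q ψ =>
    simp only [Form.covered, Form.size]
    split_ifs with h
    · omega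
    · simp
  | mod Q φ ih => simp only [Form.covered, Form.size]; omega
  | and φ χ h₁ h₂ =>
    have := union (φ.covered ν) (χ.covered ν)
    simp only [Form.covered, Form.size]; omega
  | or φ χ h₁ h₂ =>
    have := union (φ.covered ν) (χ.covered ν)
    simp only [Form.covered, Form.size]; omega

theorem sum_typeCount_setType (𝔐 : Model τ n) (w : Fin n) (π : PType τ) (A : Finset (PType τ)) :
    ∑ ρ ∈ A, typeCount (setType 𝔐 w π) ρ + (if pointType 𝔐 w ∈ A then 1 else 0) =
      ∑ ρ ∈ A, typeCount 𝔐 ρ + (if π ∈ A then 1 else 0) := by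
  have := Finset.sum_congr (rfl : A = A) fun ρ _ => typeCount_setType 𝔐 w π ρ
  simpa [Finset.sum_add_distrib] using this

/-- If the counted types include `j`, the count is at least `d` before and after the move. Otherwise
an uncovered type in the counted set means that the count exceeds the modality's depth, so losing
one point goes unnoticed. -/
theorem sat_setType_iff_of_notMem_covered {d : ℕ} {ν : PType τ → ℕ} {j : PType τ}
    {𝔐 : Model τ n} (h : ∀ π, π ≠ j → typeCount 𝔐 π = ν π) (hj : d ≤ typeCount 𝔐 j)
    {w : Fin n} (φ : Form τ) (hφ : φ.depth ≤ d)
    (hw : pointType 𝔐 w ∉ φ.covered ν) (v : Fin n) :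
    φ.Sat 𝔐 v ↔ φ.Sat (setType 𝔐 w j) v := by
  induction φ generalizing v with
  | modProp Q ψ =>
    refine Q.holds_congr ?_
    rw [ncard_counted, ncard_counted]
    have key := sum_typeCount_setType 𝔐 w j (countedTypes Q ψ)
    have hφ : Q.depth ≤ d := hφ
    by_cases hjA : j ∈ countedTypes Q ψ
    · have : typeCount 𝔐 j ≤ ∑ ρ ∈ countedTypes Q ψ, typeCount 𝔐 ρ :=
        Finset.single_le_sum (fun _ _ => Nat.zero_le _) hjA
      rw [if_pos hjA] at key
      split_ifs at key <;> omega
    · rw [if_neg hjA] at key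
      split_ifs at key with hA
      · have hsum : ∑ ρ ∈ countedTypes Q ψ, typeCount 𝔐 ρ = ∑ ρ ∈ countedTypes Q ψ, ν ρ :=
          Finset.sum_congr rfl fun ρ hρ => h ρ (by rintro rfl; exact hjA hρ)
        have hlt : Q.size < ∑ ρ ∈ countedTypes Q ψ, ν ρ := by
          by_contra hle
          exact hw (by rw [Form.covered, if_pos (not_lt.1 hle)]; exact hA)
        rw [Q.size_eq_depth] at hlt
        omega
      · omega
  | mod Q φ ih =>
    have : {v | φ.Sat 𝔐 v} = {v | φ.Sat (setType 𝔐 w j) v} :=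
      Set.ext fun v => ih (le_trans (le_max_right _ _) hφ) hw v
    simp only [Form.Sat, this]
  | and φ χ h₁ h₂ =>
    simp only [Form.covered, Finset.mem_union, not_or] at hw
    exact and_congr (h₁ (le_trans (le_max_left _ _) hφ) hw.1 v)
      (h₂ (le_trans (le_max_right _ _) hφ) hw.2 v)
  | or φ χ h₁ h₂ =>
    simp only [Form.covered, Finset.mem_union, not_or] at hw
    exact or_congr (h₁ (le_trans (le_max_left _ _) hφ) hw.1 v)
      (h₂ (le_trans (le_max_right _ _) hφ) hw.2 v)

theorem mem_covered_of_defines {d : ℕ} {ν : PType τ → ℕ} (hν : ∀ π, ν π ≤ d)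
    (hsum : ∑ π, ν π ≤ n) {φ : Form τ} (hφ : φ.depth ≤ d) (hdef : Defines φ (modelClass n d ν))
    {i j : PType τ} (hij : i ≠ j) (hj : ν j = d) (hi : 0 < ν i) : i ∈ φ.covered ν := by
  obtain ⟨𝔐, h, h'⟩ := exists_model_excess hsum j
  have hjd : d ≤ typeCount 𝔐 j := by omega
  have h𝔐 := mem_modelClass_of_excess hν hj h hjd
  have hpos : 0 < typeCount 𝔐 i := by rw [h i hij]; exact hi
  rw [typeCount_eq_card, Finset.card_pos] at hpos
  obtain ⟨w, hw⟩ := hpos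
  have hw : pointType 𝔐 w = i := by simpa using hw
  by_contra hcov
  have h𝔑 : setType 𝔐 w j ∈ modelClass n d ν := (hdef _).1 fun v =>
    (sat_setType_iff_of_notMem_covered h hjd φ hφ (by rwa [hw]) v).1 ((hdef 𝔐).2 h𝔐 v)
  have h₁ := congrFun h𝔑 i
  have h₂ := typeCount_setType 𝔐 w j i
  rw [if_pos hw, if_neg hij.symm, h i hij] at h₂
  simp only [typeTuple] at h₁
  have := hν i
  omega

theorem sum_le_descComplexity {d : ℕ} {ν : PType τ → ℕ} (hν : ∀ π, ν π ≤ d)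
    (hsum : ∑ π, ν π ≤ n) (hdef : Definable d (modelClass n d ν)) {S : Finset (PType τ)}
    (hS : ∀ i ∈ S, ∃ j, i ≠ j ∧ ν j = d) :
    ∑ π ∈ S, ν π ≤ descComplexity d (modelClass n d ν) := by
  obtain ⟨φ, h₁, h₂, h₃⟩ := exists_size_eq_descComplexity hdef
  rw [← h₃]
  refine le_trans ?_ (φ.sum_covered_le_size ν)
  refine Finset.sum_le_sum_of_ne_zero fun i hi hne => ?_
  obtain ⟨j, hij, hj⟩ := hS i hi
  exact mem_covered_of_defines hν hsum h₁ h₂ hij hj (Nat.pos_of_ne_zero hne)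

/-! ### Comparison of the numbers of models -/

/-- Each of the remaining types accounts for at most `d` points. -/
theorem le_card_filter_typeCount_gt (𝔐 : Model τ n) (d : ℕ) :
    n ≤ (Finset.univ.filter fun w => d < typeCount 𝔐 (pointType 𝔐 w)).card +
      d * Fintype.card (PType τ) := by
  have h := Finset.card_filter_add_card_filter_not (s := (Finset.univ : Finset (Fin n)))
    (fun w => d < typeCount 𝔐 (pointType 𝔐 w))
  have h' : (Finset.univ.filter fun w => ¬ d < typeCount 𝔐 (pointType 𝔐 w)).card ≤
      d * (Finset.univ : Finset (PType τ)).card := by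
    refine Finset.card_le_mul_card_image_of_maps_to (f := pointType 𝔐)
      (fun _ _ => Finset.mem_univ _) d fun π _ => ?_
    by_cases hπ : d < typeCount 𝔐 π
    · rw [Finset.filter_filter, Finset.filter_eq_empty_iff.2]
      · simp
      · rintro w - ⟨h₁, h₂⟩
        exact h₁ (h₂ ▸ hπ)
    · rw [Finset.filter_filter]
      refine le_trans (Finset.card_le_card (Finset.monotone_filter_right _ ?_))
        ((typeCount_eq_card 𝔐 π).symm.trans_le (not_lt.1 hπ))
      exact fun w _ hw => hw.2
  simp only [Finset.card_univ, Fintype.card_fin] at h h'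
  omega

theorem setType_mem_modelClass {d : ℕ} {ν : PType τ → ℕ} {i : PType τ} (hi : ν i < d)
    {𝔐 : Model τ n} (h𝔐 : 𝔐 ∈ modelClass n d ν) {w : Fin n}
    (hw : d < typeCount 𝔐 (pointType 𝔐 w)) :
    pointType 𝔐 w ≠ i ∧
      setType 𝔐 w i ∈ modelClass n d (Function.update ν i (ν i + 1)) := by
  have hne : pointType 𝔐 w ≠ i := by
    rintro rfl
    have := congrFun h𝔐 (pointType 𝔐 w)
    simp only [typeTuple] at this
    omega
  refine ⟨hne, funext fun ρ => ?_⟩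
  have h₁ := congrFun h𝔐 ρ
  have h₂ := typeCount_setType 𝔐 w i ρ
  simp only [typeTuple] at h₁ ⊢
  by_cases hρ : i = ρ
  · subst hρ
    rw [if_neg hne, if_pos rfl] at h₂
    rw [Function.update_self]
    omega
  · rw [if_neg hρ] at h₂
    rw [Function.update_of_ne (Ne.symm hρ)]
    split_ifs at h₂ with hκ
    · subst hκ; omega
    · omega

theorem card_image_setType_le {d : ℕ} (𝔑 : Model τ n) (i : PType τ) (hd : typeCount 𝔑 i ≤ d) :
    (((Finset.univ.filter fun w => pointType 𝔑 w = i) ×ˢ (Finset.univ : Finset (PType τ))).image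
      fun x => setType 𝔑 x.1 x.2).card ≤ d * Fintype.card (PType τ) := by
  refine Finset.card_image_le.trans ?_
  rw [Finset.card_product, ← typeCount_eq_card, Finset.card_univ]
  exact Nat.mul_le_mul_right _ hd

open scoped Classical in
-- Each source model has at least n - dt > dt images under moving a point to type `i`. Each target
-- has at most dt preimages, determined by the moved point and its former type.
theorem ncard_modelClass_lt_update {d : ℕ} (hn : 2 * (d * Fintype.card (PType τ)) < n)
    {ν : PType τ → ℕ} (hne : (modelClass n d ν).Nonempty) {i : PType τ} (hi : ν i < d) :
    (modelClass n d ν).ncard < (modelClass n d (Function.update ν i (ν i + 1))).ncard := by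
  set s := (modelClass n d ν).toFinite.toFinset
  set s' := (modelClass n d (Function.update ν i (ν i + 1))).toFinite.toFinset
  have hs : ∀ 𝔐, 𝔐 ∈ s ↔ 𝔐 ∈ modelClass n d ν := fun 𝔐 => Set.Finite.mem_toFinset _
  have hs' : ∀ 𝔐, 𝔐 ∈ s' ↔ 𝔐 ∈ modelClass n d (Function.update ν i (ν i + 1)) :=
    fun 𝔐 => Set.Finite.mem_toFinset _
  rw [Set.ncard_eq_toFinset_card _, Set.ncard_eq_toFinset_card _]
  change s.card < s'.card
  have hpos : 0 < s.card := by
    obtain ⟨𝔐, h𝔐⟩ := hne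
    exact Finset.card_pos.2 ⟨𝔐, (hs 𝔐).2 h𝔐⟩
  have key := Finset.card_mul_le_card_mul (s := s) (t := s')
    (fun 𝔐 𝔑 => ∃ w, d < typeCount 𝔐 (pointType 𝔐 w) ∧ setType 𝔐 w i = 𝔑)
    (m := d * Fintype.card (PType τ) + 1) (n := d * Fintype.card (PType τ)) ?_ ?_
  · by_contra hle
    have := Nat.mul_le_mul_right (d * Fintype.card (PType τ)) (not_lt.1 hle)
    rw [mul_add] at key
    omega
  · intro 𝔐 h𝔐
    have h𝔐 := (hs 𝔐).1 h𝔐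
    have hcard := le_card_filter_typeCount_gt 𝔐 d
    have hinj : Set.InjOn (fun w => setType 𝔐 w i)
        (Finset.univ.filter fun w => d < typeCount 𝔐 (pointType 𝔐 w) : Finset (Fin n)) := by
      intro v hv w hw hvw
      by_contra hne
      have hv : d < typeCount 𝔐 (pointType 𝔐 v) := by simpa using hv
      refine (setType_mem_modelClass hi h𝔐 hv).1 ?_
      have h₁ := congrArg (fun 𝔑 => pointType 𝔑 v) hvw
      simp only [pointType_setType] at h₁
      rw [h₁]
      funext p
      simp [pointType, setType, hne]
    have himage := Finset.card_image_of_injOn hinj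
    refine le_trans ?_ (Finset.card_le_card (s := (Finset.univ.filter fun w =>
      d < typeCount 𝔐 (pointType 𝔐 w)).image fun w => setType 𝔐 w i) ?_)
    · omega
    · intro 𝔑 h𝔑
      obtain ⟨w, hw, rfl⟩ := Finset.mem_image.1 h𝔑
      have hw : d < typeCount 𝔐 (pointType 𝔐 w) := by simpa using hw
      rw [Finset.mem_bipartiteAbove]
      exact ⟨(hs' _).2 (setType_mem_modelClass hi h𝔐 hw).2, w, hw, rfl⟩
  · intro 𝔑 h𝔑
    rcases le_or_gt (typeCount 𝔑 i) d with hd | hd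
    · refine le_trans (Finset.card_le_card ?_) (card_image_setType_le 𝔑 i hd)
      intro 𝔐 h𝔐
      obtain ⟨-, w, -, rfl⟩ := (Finset.mem_bipartiteBelow _).1 h𝔐
      refine Finset.mem_image.2 ⟨(w, pointType 𝔐 w), ?_, setType_pointType 𝔐 w i⟩
      simp [pointType_setType]
    -- More than `d` points of type `i` are possible when `ν i + 1 = d`; a preimage would still have
    -- at least `d` of them, contradicting `ν i < d`.
    · rw [Finset.card_eq_zero.2]
      · exact Nat.zero_le _
      · refine Finset.eq_empty_of_forall_notMem fun 𝔐 h𝔐 => ?_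
        obtain ⟨h, w, hw, rfl⟩ := (Finset.mem_bipartiteBelow _).1 h𝔐
        have h𝔐 := (hs 𝔐).1 h
        have h₁ := congrFun h𝔐 i
        have h₂ := typeCount_setType 𝔐 w i i
        rw [if_neg (setType_mem_modelClass hi h𝔐 hw).1, if_pos rfl] at h₂
        simp only [typeTuple] at h₁
        omega

theorem sum_le_of_le {d : ℕ} (hn : 2 * (d * Fintype.card (PType τ)) < n) {ν : PType τ → ℕ}
    (hν : ∀ π, ν π ≤ d) (A : Finset (PType τ)) : ∑ π ∈ A, ν π + d < n := by
  have h : ∑ π ∈ A, ν π ≤ A.card • d := Finset.sum_le_card_nsmul A ν d fun π _ => hν π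
  have h' : A.card * d ≤ d * Fintype.card (PType τ) := by
    rw [mul_comm]; exact Nat.mul_le_mul_left _ (Finset.card_le_univ A)
  have : d * 1 ≤ d * Fintype.card (PType τ) := Nat.mul_le_mul_left _ Fintype.card_pos
  rw [smul_eq_mul] at h
  omega

/-- Unit steps never touch `j`, whose coordinate is already `d`; this keeps every intermediate class
nonempty. -/
theorem ncard_modelClass_lt {d : ℕ} (hn : 2 * (d * Fintype.card (PType τ)) < n)
    {ν ν' : PType τ → ℕ} (hν' : ∀ π, ν' π ≤ d) (hle : ∀ π, ν π ≤ ν' π) (hne : ν ≠ ν')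
    {j : PType τ} (hj : ν j = d) : (modelClass n d ν).ncard < (modelClass n d ν').ncard := by
  induction hm : ∑ π, ν' π - ∑ π, ν π generalizing ν with
  | zero =>
    refine absurd (funext fun π => ?_) hne
    exact (Finset.sum_eq_sum_iff_of_le fun π _ => hle π).1
      (le_antisymm (Finset.sum_le_sum fun π _ => hle π) (Nat.sub_eq_zero_iff_le.1 hm)) π
      (Finset.mem_univ π)
  | succ m ih =>
    obtain ⟨i, hi⟩ := Function.ne_iff.1 hne
    have hi : ν i < ν' i := lt_of_le_of_ne (hle i) hi
    have hν : ∀ π, ν π ≤ d := fun π => (hle π).trans (hν' π)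
    have hstep := ncard_modelClass_lt_update hn (modelClass_nonempty hν hj
      (by have := sum_le_of_le hn hν Finset.univ; omega)) (hi.trans_le (hν' i))
    by_cases heq : Function.update ν i (ν i + 1) = ν'
    · rwa [heq] at hstep
    · refine hstep.trans (ih ?_ heq ?_ ?_)
      · intro π
        by_cases hπ : π = i
        · subst hπ; simpa using hi
        · simpa [hπ] using hle π
      · rw [Function.update_of_ne, hj]
        rintro rfl
        exact (hi.trans_le (hν' j)).ne hj
      · have h₁ := Finset.sum_update_of_mem (Finset.mem_univ i) ν (ν i + 1)
        have h₂ := Finset.add_sum_erase _ ν (Finset.mem_univ i)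
        rw [Finset.sdiff_singleton_eq_erase] at h₁
        omega

/-! ### Monotonicity of description complexity -/

theorem descComplexity_lt [Nonempty τ] {d : ℕ} (hn : 2 * (d * Fintype.card (PType τ)) < n)
    {ν ν' : PType τ → ℕ} (hν' : ∀ π, ν' π ≤ d) (hle : ∀ π, ν π ≤ ν' π)
    (hc : cTau τ < ∑ π, ((ν' π : ℤ) - (ν π : ℤ))) {j : PType τ} (hj : ν j = d) :
    descComplexity d (modelClass n d ν) < descComplexity d (modelClass n d ν') := by
  have hν : ∀ π, ν π ≤ d := fun π => (hle π).trans (hν' π)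
  have hj' : ν' j = d := le_antisymm (hν' j) (hj ▸ hle j)
  have hsum' : ∑ π, ν' π ≤ n := by have := sum_le_of_le hn hν' Finset.univ; omega
  have hdef' : Definable d (modelClass n d ν') := definable_modelClass (by omega) hν'
  have hc' : Fintype.card (PType τ) * (2 * Fintype.card τ + 1) + ∑ π, ν π ≤ ∑ π, ν' π := by
    have ht : Fintype.card (PType τ) = 2 ^ Fintype.card τ := by simp
    rw [cTau, Finset.sum_sub_distrib] at hc
    rw [ht]
    zify
    linarith
  by_cases hex : ∃ k, k ≠ j ∧ ν' k = d
  · obtain ⟨k, hkj, hk⟩ := hex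
    have hlow := sum_le_descComplexity hν' hsum' hdef' (S := Finset.univ) fun i _ => by
      by_cases hi : i = j
      · exact ⟨k, hi ▸ hkj.symm, hk⟩
      · exact ⟨j, hi, hj'⟩
    have hup := descComplexity_add_one_le (n := n) (by omega) hν
      (Finset.univ_nonempty (α := PType τ)) fun 𝔐 h => funext fun π => h π (Finset.mem_univ π)
    simp only [add_assoc] at hup
    rw [Finset.sum_add_distrib, Finset.sum_const, smul_eq_mul, Finset.card_univ] at hup
    omega
  -- Here `j` is the only maximal coordinate of `ν'`, so `ν` prescribes exact counts off `j`. They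
  -- leave at least `d` points for `j`, and its conjunct can be omitted.
  · push Not at hex
    have hlow := sum_le_descComplexity hν' hsum' hdef' (S := Finset.univ.erase j) fun i hi =>
      ⟨j, Finset.ne_of_mem_erase hi, hj'⟩
    have hS : (Finset.univ.erase j : Finset (PType τ)).Nonempty := by
      obtain ⟨k, hk⟩ := exists_ne j
      exact ⟨k, by simpa using hk⟩
    have hup := descComplexity_add_one_le (n := n) (by omega) hν hS fun 𝔐 h => by
      have hcount : ∀ π ∈ Finset.univ.erase j, typeCount 𝔐 π = ν π := by
        intro π hπ
        have h₁ := h π hπ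
        have h₂ := hex π (Finset.ne_of_mem_erase hπ)
        have h₃ := hle π
        have h₄ := hν' π
        simp only [typeTuple] at h₁
        omega
      have h₁ := sum_typeCount_univ 𝔐
      have h₃ : ∑ π ∈ Finset.univ.erase j, typeCount 𝔐 π = ∑ π ∈ Finset.univ.erase j, ν π :=
        Finset.sum_congr rfl hcount
      rw [← Finset.add_sum_erase _ _ (Finset.mem_univ j), h₃] at h₁
      have h₂ := sum_le_of_le hn hν (Finset.univ.erase j)
      exact mem_modelClass_of_excess hν hj
        (fun π hπ => hcount π (Finset.mem_erase.2 ⟨hπ, Finset.mem_univ π⟩)) (by omega)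
    simp only [add_assoc] at hup
    rw [Finset.sum_add_distrib, Finset.sum_const, smul_eq_mul] at hup
    have h₁ := Finset.add_sum_erase _ ν (Finset.mem_univ j)
    have h₂ := Finset.add_sum_erase _ ν' (Finset.mem_univ j)
    have h₃ : (Finset.univ.erase j).card * (2 * Fintype.card τ + 1) ≤
        Fintype.card (PType τ) * (2 * Fintype.card τ + 1) :=
      Nat.mul_le_mul_right _ (Finset.card_le_univ _)
    omega

/-! ### Assembly of the corollary -/

theorem Admissible.exists_eq {d : ℕ} (hn : 2 * (d * Fintype.card (PType τ)) < n)
    {ν : PType τ → ℕ} (h : Admissible n d ν) : ∃ j, ν j = d := by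
  refine h.2.2.resolve_right fun hsum => ?_
  have := sum_le_of_le hn h.1 Finset.univ
  omega

/-- Without symbols there is a single type, so a tuple attaining `d` is unique. This disposes of the
case where no propositional formula exists. -/
theorem nonempty_of_ne {d : ℕ} {ν ν' : PType τ → ℕ} (h : ∃ j, ν j = d) (h' : ∃ j, ν' j = d)
    (hne : ν ≠ ν') : Nonempty τ := by
  by_contra hτ
  rw [not_nonempty_iff] at hτ
  obtain ⟨j, hj⟩ := h
  obtain ⟨k, hk⟩ := h'
  refine hne (funext fun π => ?_)
  rw [Subsingleton.elim π j, hj, Subsingleton.elim j k, hk]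

theorem boltzmann_lt_iff {S T : Set (Model τ n)} (hS : S.Nonempty) (hT : T.Nonempty) :
    boltzmann S < boltzmann T ↔ S.ncard < T.ncard := by
  have hS := (Set.ncard_pos S.toFinite).2 hS
  have hT := (Set.ncard_pos T.toFinite).2 hT
  rw [boltzmann, boltzmann, Real.logb_lt_logb_iff one_lt_two (by exact_mod_cast hS)
    (by exact_mod_cast hT), Nat.cast_lt]

end

end GMLU

theorem mainTheorem7 {τ : Type*} [Fintype τ] [DecidableEq τ] (d : ℕ) (hd : 0 < d) :
    ∃ N : ℕ, ∀ n : ℕ, N ≤ n → ∀ ν ν' : GMLU.PType τ → ℕ,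
      GMLU.Admissible n d ν → GMLU.Admissible n d ν' → ν ≠ ν' →
      (GMLU.LeTau ν ν' ∨ GMLU.LeTau ν' ν) →
        (GMLU.modelClass n d ν ∈ (GMLU.equivSetoid τ n d).classes ∧
          GMLU.modelClass n d ν' ∈ (GMLU.equivSetoid τ n d).classes) ∧
        (GMLU.Definable d (GMLU.modelClass n d ν) ∧
          GMLU.Definable d (GMLU.modelClass n d ν')) ∧
        (GMLU.boltzmann (GMLU.modelClass n d ν) < GMLU.boltzmann (GMLU.modelClass n d ν') ↔
          GMLU.descComplexity d (GMLU.modelClass n d ν) <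
            GMLU.descComplexity d (GMLU.modelClass n d ν')) := by
  classical
  refine ⟨2 * (d * Fintype.card (GMLU.PType τ)) + 1, fun n hn ν ν' hν hν' hne hcomp => ?_⟩
  have hn : 2 * (d * Fintype.card (GMLU.PType τ)) < n := hn
  have hj := hν.exists_eq hn
  have hj' := hν'.exists_eq hn
  have := GMLU.nonempty_of_ne hj hj' hne
  obtain ⟨j, hj⟩ := hj
  obtain ⟨j', hj'⟩ := hj'
  have hM := GMLU.modelClass_nonempty hν.1 hj hν.2.1
  have hM' := GMLU.modelClass_nonempty hν'.1 hj' hν'.2.1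
  have hdef : GMLU.Definable d (GMLU.modelClass n d ν) :=
    GMLU.definable_modelClass (by omega) hν.1
  have hdef' : GMLU.Definable d (GMLU.modelClass n d ν') :=
    GMLU.definable_modelClass (by omega) hν'.1
  refine ⟨⟨GMLU.modelClass_mem_classes hM hdef, GMLU.modelClass_mem_classes hM' hdef'⟩,
    ⟨hdef, hdef'⟩, ?_⟩
  rw [GMLU.boltzmann_lt_iff hM hM']
  rcases hcomp with ⟨hle, heq | hc⟩ | ⟨hle, heq | hc⟩
  · exact absurd heq hne
  · exact iff_of_true (GMLU.ncard_modelClass_lt hn hν'.1 hle hne hj)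
      (GMLU.descComplexity_lt hn hν'.1 hle hc hj)
  · exact absurd heq.symm hne
  · exact iff_of_false (GMLU.ncard_modelClass_lt hn hν.1 hle hne.symm hj').not_gt
      (GMLU.descComplexity_lt hn hν.1 hle hc hj').not_gt
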